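/- Let $E=\{z\in\mathbb{C}:|z|<1\}$ and let $f(z)=z+a_2z^2+a_3z^3+\cdots$ be analytic in $E$. Suppose that $f$ is convex, that is, $f'(z)\neq 0$ and $$\operatorname{Re}\left(1+\frac{zf''(z)}{f'(z)}\right)>0\qquad\text{for all } z\in E.$$ Then, with $a_1=1$, the third Hankel determinant $$H_3(1)=\begin{vmatrix} a_1&a_2&a_3\\ a_2&a_3&a_4\\ a_3&a_4&a_5\end{vmatrix}$$ satisfies $$|H_3(1)|\leq\frac{15}{24}.$$ -/

import Mathlib

/-- The class `A`: functions analytic in the open unit disk `E = {z : |z| < 1}` of the form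
`f(z) = z + a₂ z² + ⋯`. -/
def classA : Set (ℂ → ℂ) :=
  {f | DifferentiableOn ℂ f (Metric.ball 0 1) ∧ f 0 = 0 ∧ deriv f 0 = 1}

/-- The class `C` of convex functions: `f ∈ A` with `Re (1 + z f''(z) / f'(z)) > 0` on the unit
disk. The quotient has to make sense, so `f'` has no zero there. -/
def classC : Set (ℂ → ℂ) :=
  {f | f ∈ classA ∧ ∀ z ∈ Metric.ball (0 : ℂ) 1,
    deriv f z ≠ 0 ∧ 0 < (1 + z * deriv (deriv f) z / deriv f z).re}

/-- The `n`-th Taylor coefficient `aₙ` of `f` at the origin. -/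
noncomputable def taylorCoeff (f : ℂ → ℂ) (n : ℕ) : ℂ :=
  iteratedDeriv n f 0 / (n.factorial : ℂ)

/-- The `q`-th Hankel determinant `H_q(n)` of `f`: the determinant of the `q × q` matrix whose
entry in row `i` and column `j` (counted from `0`) is `a_{n + i + j}`. -/
noncomputable def hankelDet (f : ℂ → ℂ) (q n : ℕ) : ℂ :=
  Matrix.det (Matrix.of fun i j : Fin q => taylorCoeff f (n + (i : ℕ) + (j : ℕ)))

/-! Convexity says that `p = 1 + z f'' / f'` has positive real part, and `p 0 = 1`, so
Carathéodory's bound gives `|pₖ| ≤ 2` for its Taylor coefficients. Comparing coefficients in `(z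
f')' = p f'` expresses `a₂, …, a₅` as polynomials in `p₁, …, p₄`, so `H₃(1)` becomes one too. After
cancellation, the triangle inequality term by term already gives `1920 / 8640 = 2/9`, well below
`15/24`. -/

open Metric ComplexConjugate in
/-- **Carathéodory's coefficient bound** on a circle of radius `r`. -/
theorem norm_iteratedDeriv_mul_pow_le_of_re_nonneg {p : ℂ → ℂ} {r : ℝ} (hr : 0 < r)
    (hp : DiffContOnCl ℂ p (ball 0 r)) (hre : ∀ z ∈ sphere (0 : ℂ) r, 0 ≤ (p z).re)
    {k : ℕ} (hk : k ≠ 0) :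
    ‖iteratedDeriv k p 0‖ * r ^ k ≤ 2 * (p 0).re * k.factorial := by
  have hne : ∀ z ∈ sphere (0 : ℂ) |r|, z ≠ 0 := by
    rintro z hz rfl
    simp [hr.ne', eq_comm] at hz
  have hpc : ContinuousOn p (sphere (0 : ℂ) |r|) := by
    rw [abs_of_pos hr]
    refine hp.continuousOn.mono ?_
    rw [closure_ball _ hr.ne']
    exact sphere_subset_closedBall
  have hinv : ContinuousOn (fun z : ℂ => z⁻¹ ^ k) (sphere (0 : ℂ) |r|) :=
    (continuousOn_id.inv₀ hne).pow k
  have hpc' : ContinuousOn (fun z : ℂ => conj (p z)) (sphere (0 : ℂ) |r|) :=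
    Complex.continuous_conj.comp_continuousOn hpc
  have hcauchy : Real.circleAverage (fun z => p z * z⁻¹ ^ k) 0 r
      = iteratedDeriv k p 0 / k.factorial := by
    have h := DiffContOnCl.circleIntegral_one_div_sub_center_pow_smul hr k hp
    rw [Real.circleAverage_eq_circleIntegral hr.ne']
    have e : (∮ z in C(0, r), (z - 0)⁻¹ • (p z * z⁻¹ ^ k))
        = ∮ z in C(0, r), (1 / (z - 0) ^ (k + 1)) • p z := by
      congr 1
      funext z
      simp only [smul_eq_mul, sub_zero, one_div, pow_succ, mul_inv, inv_pow]
      ring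
    rw [e, h]
    have : (2 * Real.pi * Complex.I : ℂ) ≠ 0 := Complex.two_pi_I_ne_zero
    simp only [smul_eq_mul]
    field_simp
  have hzero : Real.circleAverage (fun z => p z * z ^ k) 0 r = 0 := by
    have hd : DiffContOnCl ℂ (fun z => p z * z ^ k) (ball 0 |r|) := by
      rw [abs_of_pos hr]
      exact hp.smul (differentiable_pow k).diffContOnCl
    simpa [hk] using hd.circleAverage
  -- Conjugate `hzero`: on the circle `conj z = r² / z`. Adding this zero average to Cauchy's
  -- formula replaces `p` by `2 Re p`, whose absolute value can be dropped and whose mean is `2 Re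
  -- p(0)`.
  have hconj : Real.circleAverage (fun z => conj (p z) * z⁻¹ ^ k) 0 r = 0 := by
    have hi : CircleIntegrable (fun z => p z * z ^ k) 0 r :=
      ContinuousOn.circleIntegrable' (hpc.mul (continuousOn_pow k))
    have h1 := (Complex.conjCLE : ℂ →L[ℝ] ℂ).circleAverage_comp_comm hi
    rw [hzero, map_zero] at h1
    have h2 : Real.circleAverage (fun z => conj (p z) * z⁻¹ ^ k) 0 r
        = Real.circleAverage (((r : ℂ) ^ (2 * k))⁻¹ •
          ((Complex.conjCLE : ℂ →L[ℝ] ℂ) ∘ fun z => p z * z ^ k)) 0 r := by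
      refine Real.circleAverage_congr_sphere fun z hz => ?_
      have hz0 := hne z hz
      have hzz : z * conj z = (r : ℂ) ^ 2 := by
        rw [Complex.mul_conj, Complex.normSq_eq_norm_sq]
        simp at hz
        rw [hz]; simp
      simp only [Pi.smul_apply, Function.comp_apply, smul_eq_mul, pow_mul, ← hzz]
      have hc0 : conj z ≠ 0 := by simpa using hz0
      simp [mul_pow]
      field_simp
    rw [h2, Real.circleAverage_smul, h1, smul_zero]
  have hsum : Real.circleAverage (fun z => ((2 * (p z).re : ℝ) : ℂ) * z⁻¹ ^ k) 0 r
      = iteratedDeriv k p 0 / k.factorial := by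
    have hadd := Real.circleAverage_fun_add (ContinuousOn.circleIntegrable' (hpc.mul hinv))
      (ContinuousOn.circleIntegrable' (hpc'.mul hinv))
    simp only [Pi.mul_apply] at hadd
    rw [← hcauchy]
    refine Eq.trans ?_ (hadd.trans ((congrArg _ hconj).trans (add_zero _)))
    congr 1
    funext z
    rw [← add_mul, Complex.add_conj]
  have hmean : Real.circleAverage (fun z => (p z).re) 0 r = (p 0).re := by
    have h1 := Complex.reCLM.circleAverage_comp_comm
      (ContinuousOn.circleIntegrable' hpc : CircleIntegrable p 0 r)
    have hd : DiffContOnCl ℂ p (ball 0 |r|) := by rwa [abs_of_pos hr]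
    rw [hd.circleAverage] at h1
    simpa [Function.comp_def] using h1
  have hnorm : ‖iteratedDeriv k p 0 / k.factorial‖ ≤ 2 * (p 0).re * r⁻¹ ^ k := by
    calc ‖iteratedDeriv k p 0 / k.factorial‖
        ≤ Real.circleAverage (fun z => ‖((2 * (p z).re : ℝ) : ℂ) * z⁻¹ ^ k‖) 0 r := by
          rw [← hsum, Real.circleAverage, Real.circleAverage, norm_smul, smul_eq_mul,
            Real.norm_of_nonneg (by positivity)]
          gcongr
          exact intervalIntegral.norm_integral_le_integral_norm (by positivity)
      _ = Real.circleAverage ((2 * r⁻¹ ^ k) • fun z => (p z).re) 0 r := by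
          refine Real.circleAverage_congr_sphere fun z hz => ?_
          rw [abs_of_pos hr] at hz
          have hzr : ‖z‖ = r := by simpa using hz
          have := hre z hz
          simp only [norm_mul, norm_pow, norm_inv, hzr, Pi.smul_apply, smul_eq_mul,
            Complex.norm_real, Real.norm_of_nonneg (mul_nonneg zero_le_two this)]
          ring
      _ = 2 * (p 0).re * r⁻¹ ^ k := by
          rw [Real.circleAverage_smul, hmean, smul_eq_mul]
          ring
  have hf : (0 : ℝ) < k.factorial := by exact_mod_cast k.factorial_pos
  rw [norm_div, Complex.norm_natCast, div_le_iff₀ hf, inv_pow] at hnorm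
  calc ‖iteratedDeriv k p 0‖ * r ^ k
      ≤ 2 * (p 0).re * (r ^ k)⁻¹ * k.factorial * r ^ k := by gcongr
    _ = 2 * (p 0).re * k.factorial := by field_simp

open Metric in
/-- **Carathéodory's coefficient bound**: a function on the unit disk with nonnegative real part
and `Re p(0) = c` has Taylor coefficients of modulus at most `2 c`. -/
theorem norm_iteratedDeriv_le_of_re_nonneg {p : ℂ → ℂ} (hp : DifferentiableOn ℂ p (ball 0 1))
    (hre : ∀ z ∈ ball (0 : ℂ) 1, 0 ≤ (p z).re) {k : ℕ} (hk : k ≠ 0) :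
    ‖iteratedDeriv k p 0‖ ≤ 2 * (p 0).re * k.factorial := by
  -- No boundary values on the unit circle are assumed, so the bound is taken on radius `r < 1` and
  -- `r → 1`.
  have hlim : Filter.Tendsto (fun r : ℝ => ‖iteratedDeriv k p 0‖ * r ^ k)
      (nhdsWithin 1 (Set.Iio 1)) (nhds (‖iteratedDeriv k p 0‖ * 1 ^ k)) :=
    (Continuous.tendsto (by fun_prop) 1).mono_left nhdsWithin_le_nhds
  rw [one_pow, mul_one] at hlim
  refine le_of_tendsto hlim ?_
  filter_upwards [Ioo_mem_nhdsLT (zero_lt_one' ℝ)] with r hr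
  have hsub : closedBall (0 : ℂ) r ⊆ ball 0 1 := closedBall_subset_ball hr.2
  exact norm_iteratedDeriv_mul_pow_le_of_re_nonneg hr.1 (hp.diffContOnCl_ball hsub)
    (fun z hz => hre z (hsub (sphere_subset_closedBall hz))) hk

/-- If `(z g)' = p g` near `0`, the derivatives of `g` at `0` satisfy the Leibniz recurrence. -/
theorem succ_mul_iteratedDeriv_eq_sum_of_deriv_id_mul {p g : ℂ → ℂ} (hp : AnalyticAt ℂ p 0)
    (hg : AnalyticAt ℂ g 0) (h : deriv (id * g) =ᶠ[nhds 0] p * g) (n : ℕ) :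
    (n + 1) * iteratedDeriv n g 0 = ∑ i ∈ Finset.range (n + 1),
      n.choose i * iteratedDeriv i p 0 * iteratedDeriv (n - i) g 0 := by
  -- In the Leibniz sum for the derivative of order `n + 1` of `z g`, only `i = 1` survives at `0`.
  rw [← iteratedDeriv_mul hp.contDiffAt hg.contDiffAt, ← h.iteratedDeriv_eq n,
    ← iteratedDeriv_succ', iteratedDeriv_mul contDiffAt_id hg.contDiffAt,
    Finset.sum_eq_single 1]
  · simp [iteratedDeriv_id]
  · intro i _ hi
    simp only [iteratedDeriv_id]
    rcases i with _ | _ | i <;> simp_all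
  · simp

/-- `H₃(1) = P(p₁, p₂, p₃, p₄) / 8640` for `(z f')' = p f'` and `p = 1 + p₁ z + ⋯`; this bounds
the polynomial `P`. -/
theorem norm_hankelPolynomial_le {p₁ p₂ p₃ p₄ : ℂ} (h₁ : ‖p₁‖ ≤ 2) (h₂ : ‖p₂‖ ≤ 2) (h₃ : ‖p₃‖ ≤ 2)
    (h₄ : ‖p₄‖ ≤ 2) :
    ‖-p₁ ^ 6 + 6 * p₁ ^ 4 * p₂ + 12 * p₁ ^ 3 * p₃ - 21 * p₁ ^ 2 * p₂ ^ 2 - 36 * p₁ ^ 2 * p₄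
      + 36 * p₁ * p₂ * p₃ - 4 * p₂ ^ 3 + 72 * p₂ * p₄ - 60 * p₃ ^ 2‖ ≤ 1920 := by
  have b₁ : ‖-p₁ ^ 6‖ ≤ 2 ^ 6 := by rw [norm_neg, norm_pow]; gcongr
  have b₂ : ‖6 * p₁ ^ 4 * p₂‖ ≤ 6 * 2 ^ 4 * 2 := by
    simp only [norm_mul, norm_pow, Complex.norm_ofNat]; gcongr
  have b₃ : ‖12 * p₁ ^ 3 * p₃‖ ≤ 12 * 2 ^ 3 * 2 := by
    simp only [norm_mul, norm_pow, Complex.norm_ofNat]; gcongr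
  have b₄ : ‖21 * p₁ ^ 2 * p₂ ^ 2‖ ≤ 21 * 2 ^ 2 * 2 ^ 2 := by
    simp only [norm_mul, norm_pow, Complex.norm_ofNat]; gcongr
  have b₅ : ‖36 * p₁ ^ 2 * p₄‖ ≤ 36 * 2 ^ 2 * 2 := by
    simp only [norm_mul, norm_pow, Complex.norm_ofNat]; gcongr
  have b₆ : ‖36 * p₁ * p₂ * p₃‖ ≤ 36 * 2 * 2 * 2 := by
    simp only [norm_mul, Complex.norm_ofNat]; gcongr
  have b₇ : ‖4 * p₂ ^ 3‖ ≤ 4 * 2 ^ 3 := by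
    simp only [norm_mul, norm_pow, Complex.norm_ofNat]; gcongr
  have b₈ : ‖72 * p₂ * p₄‖ ≤ 72 * 2 * 2 := by
    simp only [norm_mul, Complex.norm_ofNat]; gcongr
  have b₉ : ‖60 * p₃ ^ 2‖ ≤ 60 * 2 ^ 2 := by
    simp only [norm_mul, norm_pow, Complex.norm_ofNat]; gcongr
  refine (norm_sub_le_of_le (norm_add_le_of_le (norm_sub_le_of_le (norm_add_le_of_le
    (norm_sub_le_of_le (norm_sub_le_of_le (norm_add_le_of_le (norm_add_le_of_le b₁ b₂) b₃) b₄)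
    b₅) b₆) b₇) b₈) b₉).trans ?_
  norm_num

theorem corollary3p6 (f : ℂ → ℂ) (hf : f ∈ classC) :
    ‖hankelDet f 3 1‖ ≤ 15 / 24 := by
  obtain ⟨⟨hd, -, hf1⟩, hconv⟩ := hf
  have hopen : IsOpen (Metric.ball (0 : ℂ) 1) := Metric.isOpen_ball
  have h0 : (0 : ℂ) ∈ Metric.ball (0 : ℂ) 1 := by simp
  have hd1 : DifferentiableOn ℂ (deriv f) (Metric.ball 0 1) := hd.deriv hopen
  have hd2 : DifferentiableOn ℂ (deriv (deriv f)) (Metric.ball 0 1) := hd1.deriv hopen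
  set p : ℂ → ℂ := fun z => 1 + z * deriv (deriv f) z / deriv f z with hpdef
  have hp : DifferentiableOn ℂ p (Metric.ball 0 1) :=
    (differentiableOn_const 1).add ((differentiableOn_id.mul hd2).div hd1 fun z hz => (hconv z hz).1)
  have hp0 : p 0 = 1 := by simp [hpdef]
  have hpk : ∀ k : ℕ, k ≠ 0 → ‖iteratedDeriv k p 0 / k.factorial‖ ≤ 2 := by
    intro k hk
    have h := norm_iteratedDeriv_le_of_re_nonneg hp (fun z hz => (hconv z hz).2.le) hk
    rw [hp0, Complex.one_re, mul_one] at h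
    rw [norm_div, Complex.norm_natCast, div_le_iff₀ (by exact_mod_cast k.factorial_pos)]
    exact h
  have hfe : deriv (id * deriv f) =ᶠ[nhds 0] p * deriv f := by
    filter_upwards [hopen.mem_nhds h0] with z hz
    have hz1 := (hconv z hz).1
    rw [deriv_mul differentiableAt_id (hd1.differentiableAt (hopen.mem_nhds hz))]
    simp only [hpdef, deriv_id, id, Pi.mul_apply]
    field_simp
  have hrec := succ_mul_iteratedDeriv_eq_sum_of_deriv_id_mul
    (hp.analyticAt (hopen.mem_nhds h0)) (hd1.analyticAt (hopen.mem_nhds h0)) hfe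
  -- As `g = f'`, `hrec n` concerns order `n + 1` of `f`. Its `i = 0` term has factor `p 0 = 1` and
  -- cancels against the left side, leaving the factor `n` divided out below.
  simp only [← iteratedDeriv_succ'] at hrec
  have r₁ := hrec 1
  have r₂ := hrec 2
  have r₃ := hrec 3
  have r₄ := hrec 4
  have c₁ := hpk 1 (by norm_num)
  have c₂ := hpk 2 (by norm_num)
  have c₃ := hpk 3 (by norm_num)
  have c₄ := hpk 4 (by norm_num)
  have hb := norm_hankelPolynomial_le c₁ c₂ c₃ c₄
  have d₁ : iteratedDeriv 1 f 0 = 1 := by rw [iteratedDeriv_one, hf1]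
  simp only [Finset.sum_range_succ, Finset.sum_range_zero, Nat.choose, iteratedDeriv_zero, hp0,
    d₁, Nat.reduceAdd, Nat.reduceSub, Nat.sub_zero, Nat.cast_ofNat, Nat.cast_one, zero_add, one_mul,
    mul_one] at r₁ r₂ r₃ r₄
  have e₂ : iteratedDeriv 2 f 0 = iteratedDeriv 1 p 0 := by linear_combination r₁
  rw [e₂] at r₂ r₃ r₄
  have e₃ : iteratedDeriv 3 f 0 = iteratedDeriv 1 p 0 ^ 2 + iteratedDeriv 2 p 0 / 2 := by
    linear_combination r₂ / 2
  rw [e₃] at r₃ r₄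
  have e₄ : iteratedDeriv 4 f 0 = iteratedDeriv 1 p 0 ^ 3
      + 3 / 2 * iteratedDeriv 1 p 0 * iteratedDeriv 2 p 0 + iteratedDeriv 3 p 0 / 3 := by
    linear_combination r₃ / 3
  rw [e₄] at r₄
  have e₅ : iteratedDeriv 5 f 0 = iteratedDeriv 1 p 0 ^ 4
      + 3 * iteratedDeriv 1 p 0 ^ 2 * iteratedDeriv 2 p 0
      + 3 / 4 * iteratedDeriv 2 p 0 ^ 2
      + 4 / 3 * iteratedDeriv 1 p 0 * iteratedDeriv 3 p 0 + iteratedDeriv 4 p 0 / 4 := by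
    linear_combination r₄ / 4
  have hdet : hankelDet f 3 1 = (1 / 8640) * (-(iteratedDeriv 1 p 0 / (Nat.factorial 1 : ℂ)) ^ 6
      + 6 * (iteratedDeriv 1 p 0 / (Nat.factorial 1 : ℂ)) ^ 4
        * (iteratedDeriv 2 p 0 / (Nat.factorial 2 : ℂ))
      + 12 * (iteratedDeriv 1 p 0 / (Nat.factorial 1 : ℂ)) ^ 3
        * (iteratedDeriv 3 p 0 / (Nat.factorial 3 : ℂ))
      - 21 * (iteratedDeriv 1 p 0 / (Nat.factorial 1 : ℂ)) ^ 2
        * (iteratedDeriv 2 p 0 / (Nat.factorial 2 : ℂ)) ^ 2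
      - 36 * (iteratedDeriv 1 p 0 / (Nat.factorial 1 : ℂ)) ^ 2
        * (iteratedDeriv 4 p 0 / (Nat.factorial 4 : ℂ))
      + 36 * (iteratedDeriv 1 p 0 / (Nat.factorial 1 : ℂ))
        * (iteratedDeriv 2 p 0 / (Nat.factorial 2 : ℂ))
        * (iteratedDeriv 3 p 0 / (Nat.factorial 3 : ℂ))
      - 4 * (iteratedDeriv 2 p 0 / (Nat.factorial 2 : ℂ)) ^ 3
      + 72 * (iteratedDeriv 2 p 0 / (Nat.factorial 2 : ℂ))
        * (iteratedDeriv 4 p 0 / (Nat.factorial 4 : ℂ))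
      - 60 * (iteratedDeriv 3 p 0 / (Nat.factorial 3 : ℂ)) ^ 2) := by
    simp only [hankelDet, taylorCoeff, Matrix.det_fin_three, Matrix.of_apply, Fin.val_zero,
      Fin.val_one, Fin.val_two, Nat.reduceAdd, add_zero, Nat.factorial, Nat.reduceMul,
      Nat.succ_eq_add_one, zero_add, mul_one, d₁, e₂, e₃, e₄, e₅]
    push_cast
    ring
  rw [hdet, norm_mul]
  have h8640 : ‖(1 / 8640 : ℂ)‖ = 1 / 8640 := by simp
  rw [h8640]
  -- `1920 / 8640 = 2/9 ≤ 15/24`.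
  linarith
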